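/- Let $\mathbb{F}_q$ be the finite field with $q$ elements. For a sequence $\mathcal{S}=(s_i)_{i=0}^\infty$ over $\mathbb{F}_q$ let $G(x)=\sum_{i=0}^\infty s_i x^i\in\mathbb{F}_q[[x]]$ be its generating function. For a positive integer $N$, the $N$th expansion complexity $E_N(\mathcal{S})$ is defined to be $0$ if $s_0=\cdots=s_{N-1}=0$, and otherwise the least total degree of a nonzero polynomial $h(x,y)\in\mathbb{F}_q[x,y]$ with $h(x,G(x))\equiv 0 \bmod x^N$. Let $\mu_q$ be the uniform probability measure on $\mathbb{F}_q$, which assigns measure $1/q$ to each element, and let $\mu_q^\infty$ be the complete product probability measure on the sequence space $\mathbb{F}_q^\infty$ induced by $\mu_q$. Then $$\liminf_{N\to\infty}\frac{E_N(\mathcal{S})}{N^{1/2}}\ge 1$$ for $\mu_q^\infty$-almost every sequence $\mathcal{S}\in\mathbb{F}_q^\infty$. -/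

import Mathlib

open MeasureTheory Filter

noncomputable section

/-- The generating function `G(x) = ∑ sᵢ xⁱ` of a sequence, as a formal power series. -/
def generatingFunction {F : Type*} [Field F] (S : ℕ → F) : PowerSeries F :=
  PowerSeries.mk S

/-- `IsExpansionRelation S N h`: the polynomial `h(x, y)` is nonzero and
`h(x, G(x)) ≡ 0 mod x ^ N`. The variable `x` has index `0`, and `y` has index `1`. -/
def IsExpansionRelation {F : Type*} [Field F] (S : ℕ → F) (N : ℕ)
    (h : MvPolynomial (Fin 2) F) : Prop :=
  h ≠ 0 ∧ (PowerSeries.X : PowerSeries F) ^ N ∣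
    MvPolynomial.aeval ![(PowerSeries.X : PowerSeries F), generatingFunction S] h

/-- An expansion relation always exists (for instance `x ^ N`), so the least total degree
in the definition of the expansion complexity is attained. -/
theorem exists_isExpansionRelation {F : Type*} [Field F] (S : ℕ → F) (N : ℕ) :
    ∃ h : MvPolynomial (Fin 2) F, IsExpansionRelation S N h :=
  ⟨MvPolynomial.X 0 ^ N, pow_ne_zero _ (MvPolynomial.X_ne_zero 0), by simp⟩

open Classical in
/-- The `N`th expansion complexity: `0` if the first `N` terms all vanish, and otherwise the
least total degree of a nonzero `h(x, y)` with `h(x, G(x)) ≡ 0 mod x ^ N`. -/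
def expansionComplexity {F : Type*} [Field F] (S : ℕ → F) (N : ℕ) : ℕ :=
  if ∀ i < N, S i = 0 then 0
  else sInf {d : ℕ | ∃ h : MvPolynomial (Fin 2) F,
    IsExpansionRelation S N h ∧ h.totalDegree = d}

/-- The uniform probability measure on a finite field. -/
def uniformMeasure (F : Type*) [Field F] [Fintype F] [MeasurableSpace F] : Measure F :=
  (PMF.uniformOfFintype F).toMeasure

instance uniformMeasure_isProbabilityMeasure (F : Type*) [Field F] [Fintype F] [MeasurableSpace F] :
    IsProbabilityMeasure (uniformMeasure F) :=
  inferInstanceAs (IsProbabilityMeasure (PMF.uniformOfFintype F).toMeasure)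

/-- The product measure on the sequence space whose factors are all the uniform probability
measure. Null sets, and so almost everywhere statements, are the same for its completion. -/
def uniformSequenceMeasure (F : Type*) [Field F] [Fintype F] [MeasurableSpace F] :
    Measure (ℕ → F) :=
  Measure.infinitePi fun _ : ℕ => uniformMeasure F

end

/-! ### Hensel's lemma for power series over a field. -/

namespace PowerSeries

variable {F : Type*} [Field F]

/-! Fix `c < 1` and suppose that `E_N < c √N`. Both total degree and order of vanishing at `(x, G)`
are additive over factors, so some irreducible factor `f` of a minimal relation, of degree `k ≤ c
√N`, vanishes to order at least `n = ⌈√N k / c⌉`.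

For irreducible `f`, the `y`-discriminant has degree at most `k(k-1)` and is nonzero, and the square
of `f_y(x, G)` divides it up to a high power of `x`; hence `f_y(x, G)` has order at most `k(k-1)/2`.
By Hensel's lemma `G` agrees with one of at most `k` power series roots of `f` modulo `x^(n -
k(k-1)/2)` (`exists_root_of_irreducible`).

There are at most `q^((k+1)(k+2)/2)` candidates `f`, so the union bound gives probability at most `k
q^(k²+k+1-n)`. Since `k ≤ c √N`, this decays like `exp(-a √N)` with `a > 0`, up to polynomial
factors. Sum over `k`, apply Borel–Cantelli over `N`, and let `c → 1`. -/

theorem exists_forall_X_pow_dvd_sub (r : ℕ → PowerSeries F)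
    (hr : ∀ n, (X : PowerSeries F) ^ n ∣ r (n + 1) - r n) :
    ∃ l, ∀ n, (X : PowerSeries F) ^ n ∣ l - r n := by
  have key : ∀ n k, (X : PowerSeries F) ^ n ∣ r (n + k) - r n := by
    intro n k
    induction k with
    | zero => simp
    | succ k ih =>
      have := dvd_add ((pow_dvd_pow X (Nat.le_add_right n k)).trans (hr (n + k))) ih
      rwa [sub_add_sub_cancel] at this
  refine ⟨mk fun n => coeff n (r (n + 1)), fun n => X_pow_dvd_iff.2 fun m hm => ?_⟩
  obtain ⟨k, rfl⟩ := Nat.exists_eq_add_of_le (Nat.succ_le_of_lt hm)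
  have := X_pow_dvd_iff.1 (key (m + 1) k) m (Nat.lt_succ_self m)
  rw [map_sub, sub_eq_zero] at this
  simp [this]

theorem eq_zero_of_forall_X_pow_dvd {g : PowerSeries F}
    (h : ∀ n, (X : PowerSeries F) ^ n ∣ g) : g = 0 := by
  ext n
  simpa using X_pow_dvd_iff.1 (h (n + 1)) n (Nat.lt_succ_self n)

theorem exists_eq_X_pow_mul_isUnit {g : PowerSeries F} {n : ℕ}
    (h : ¬ (X : PowerSeries F) ^ (n + 1) ∣ g) :
    ∃ e ≤ n, ∃ u, IsUnit u ∧ g = X ^ e * u := by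
  have h0 : g ≠ 0 := by rintro rfl; simp at h
  refine ⟨g.order.toNat, ?_, divXPowOrder g, ?_, X_pow_order_mul_divXPowOrder.symm⟩
  · by_contra! hlt
    exact h ((pow_dvd_pow X hlt).trans X_pow_order_dvd)
  · rw [isUnit_iff_constantCoeff, isUnit_iff_ne_zero, Ne, constantCoeff_divXPowOrder_eq_zero_iff]
    exact h0

open Polynomial in
/-- One step of the Newton iteration. -/
theorem exists_newton_step (f : (PowerSeries F)[X]) {e n : ℕ} (hn : 2 * e < n)
    {r : PowerSeries F} (h : (X : PowerSeries F) ^ n ∣ f.eval r)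
    (hd : ∃ u, IsUnit u ∧ f.derivative.eval r = X ^ e * u) :
    ∃ r', ((X : PowerSeries F) ^ (n + 1) ∣ f.eval r' ∧
      ∃ u, IsUnit u ∧ f.derivative.eval r' = X ^ e * u) ∧
      (X : PowerSeries F) ^ (n - e) ∣ r' - r := by
  obtain ⟨u, hu, hfu⟩ := hd
  obtain ⟨c, hc⟩ := h
  obtain ⟨v, huv⟩ := hu.exists_right_inv
  -- The Newton correction `-f(r)/f'(r)`, where `v` inverts `u`. Its square has order at least `2(n
  -- - e) ≥ n + 1`, and it moves `f'` only by a multiple of `X^(e+1)`.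
  obtain ⟨k, hk⟩ := Polynomial.binomExpansion f r (-(X ^ (n - e) * c * v))
  refine ⟨r + -(X ^ (n - e) * c * v), ⟨?_, ?_⟩, ?_⟩
  · have h1 : (X : PowerSeries F) ^ n = X ^ e * X ^ (n - e) := by
      rw [← pow_add]; congr 1; omega
    have h2 : f.eval r + f.derivative.eval r * -(X ^ (n - e) * c * v) = 0 := by
      rw [hc, hfu, h1]
      linear_combination (- X ^ e * X ^ (n - e) * c) * huv
    rw [hk, h2, zero_add, neg_sq, mul_pow, mul_pow, ← pow_mul]
    exact Dvd.dvd.mul_left (Dvd.dvd.mul_right (Dvd.dvd.mul_right (pow_dvd_pow _ (by omega)) _) _) _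
  · obtain ⟨w, hw⟩ := Polynomial.sub_dvd_eval_sub (r + -(X ^ (n - e) * c * v)) r f.derivative
    have h1 : (X : PowerSeries F) ^ (n - e) = X ^ e * (X * X ^ (n - 2 * e - 1)) := by
      rw [← pow_succ', ← pow_add]; congr 1; omega
    refine ⟨u + X * (X ^ (n - 2 * e - 1) * -(c * v * w)), ?_, ?_⟩
    · rw [isUnit_iff_constantCoeff] at hu ⊢
      simpa using hu
    · rw [sub_eq_iff_eq_add.1 hw, hfu, h1]
      ring
  · rw [add_sub_cancel_left, dvd_neg, mul_assoc]
    exact dvd_mul_right _ _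

open Polynomial in
/-- **Hensel's lemma** for power series: an approximate root at which the derivative does not
vanish to too high an order lies close to a root. -/
theorem exists_root_of_X_pow_dvd (f : (PowerSeries F)[X]) (g : PowerSeries F) {e n : ℕ}
    (hn : 2 * e < n) (h : (X : PowerSeries F) ^ n ∣ f.eval g)
    (hd : ¬ (X : PowerSeries F) ^ (e + 1) ∣ f.derivative.eval g) :
    ∃ r, f.IsRoot r ∧ (X : PowerSeries F) ^ (n - e) ∣ r - g := by
  obtain ⟨d, hde, hd'⟩ := exists_eq_X_pow_mul_isUnit hd
  -- The invariant sits inside the existential so that `choose` yields a total function; `0` is a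
  -- junk value where it fails.
  have step : ∀ k (s : PowerSeries F), ∃ s', ((X : PowerSeries F) ^ (n + k) ∣ f.eval s ∧
      ∃ u, IsUnit u ∧ f.derivative.eval s = X ^ d * u) →
      ((X : PowerSeries F) ^ (n + (k + 1)) ∣ f.eval s' ∧
      ∃ u, IsUnit u ∧ f.derivative.eval s' = X ^ d * u) ∧
      (X : PowerSeries F) ^ (n + k - d) ∣ s' - s := by
    intro k s
    by_cases hs : (X : PowerSeries F) ^ (n + k) ∣ f.eval s ∧
      ∃ u, IsUnit u ∧ f.derivative.eval s = X ^ d * u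
    · obtain ⟨s', hs'⟩ := exists_newton_step f (by omega) hs.1 hs.2
      exact ⟨s', fun _ => hs'⟩
    · exact ⟨0, fun h => absurd h hs⟩
  choose next hnext using step
  let r : ℕ → PowerSeries F := fun k => Nat.rec g next k
  have hP : ∀ k, (X : PowerSeries F) ^ (n + k) ∣ f.eval (r k) ∧
      ∃ u, IsUnit u ∧ f.derivative.eval (r k) = X ^ d * u := by
    intro k
    induction k with
    | zero => exact ⟨h, hd'⟩
    | succ k ih => exact (hnext k (r k) ih).1
  have hr : ∀ k, (X : PowerSeries F) ^ (n - d + k) ∣ r (k + 1) - r k := fun k =>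
    (pow_dvd_pow X (by omega)).trans (hnext k (r k) (hP k)).2
  obtain ⟨l, hl⟩ := exists_forall_X_pow_dvd_sub r
    fun k => (pow_dvd_pow X (Nat.le_add_left k _)).trans (hr k)
  refine ⟨l, eq_zero_of_forall_X_pow_dvd fun k => ?_, ?_⟩
  · have h1 := (hl k).trans (Polynomial.sub_dvd_eval_sub l (r k) f)
    have h2 := (pow_dvd_pow X (Nat.le_add_left k n)).trans (hP k).1
    simpa using dvd_add h1 h2
  · have h1 : ∀ k, (X : PowerSeries F) ^ (n - d) ∣ r k - g := by
      intro k
      induction k with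
      | zero => simp [r]
      | succ k ih =>
        have := dvd_add ((pow_dvd_pow X (Nat.le_add_right (n - d) k)).trans (hr k)) ih
        rwa [sub_add_sub_cancel] at this
    have h2 := dvd_add (hl (n - d)) (h1 (n - d))
    rw [sub_add_sub_cancel] at h2
    exact (pow_dvd_pow X (by omega)).trans h2

end PowerSeries

/-! ### Degree of the resultant of bivariate polynomials. -/

namespace Polynomial

/-- The Sylvester matrix is homogeneous for a weighting: the degree of a nonzero entry is at most a
column weight minus its row index. Every term of the Leibniz expansion thus has the same bound, the
sum of the column weights minus the sum of the row indices. -/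
theorem natDegree_resultant_le {R : Type*} [CommRing R] {f g : R[X][X]} {k l m n : ℕ}
    (hf : ∀ i, f.coeff i ≠ 0 → (f.coeff i).natDegree + i ≤ k)
    (hg : ∀ i, g.coeff i ≠ 0 → (g.coeff i).natDegree + i ≤ l) :
    (resultant f g m n).natDegree ≤ m * l + n * k - m * n := by
  have hentry : ∀ (i j : Fin (m + n)), sylvester f g m n i j ≠ 0 →
      (sylvester f g m n i j).natDegree + i ≤
        Fin.addCases (fun a : Fin m => l + (a : ℕ)) (fun b : Fin n => k + (b : ℕ)) j := by
    intro i j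
    induction j using Fin.addCases with
    | left a =>
      simp only [sylvester, Matrix.of_apply, Fin.addCases_left]
      split_ifs with h
      · intro h0
        have := hg _ h0
        have := h.1
        omega
      · simp
    | right b =>
      simp only [sylvester, Matrix.of_apply, Fin.addCases_right]
      split_ifs with h
      · intro h0
        have := hf _ h0
        have := h.1
        omega
      · simp
  have hsum : ∀ p : ℕ, 2 * ∑ i : Fin p, (i : ℕ) + p = p * p := by
    intro p
    rw [Fin.sum_univ_eq_sum_range (fun i => i) p, mul_comm, Finset.sum_range_id_mul_two]
    cases p <;> (simp; try ring)
  have hcols : ∑ j : Fin (m + n), Fin.addCases (motive := fun _ => ℕ)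
      (fun a : Fin m => l + (a : ℕ)) (fun b : Fin n => k + (b : ℕ)) j + m * n =
      m * l + n * k + ∑ j : Fin (m + n), (j : ℕ) := by
    rw [Fin.sum_univ_add]
    simp only [Fin.addCases_left, Fin.addCases_right, Finset.sum_add_distrib, Finset.sum_const,
      Finset.card_univ, Fintype.card_fin, smul_eq_mul]
    have h1 := hsum m
    have h2 := hsum n
    have h3 := hsum (m + n)
    nlinarith
  rw [resultant, Matrix.det_apply]
  refine natDegree_sum_le_of_forall_le _ _ fun σ _ => ?_
  by_cases h0 : ∀ j, sylvester f g m n (σ j) j ≠ 0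
  · have h1 : (∏ j, sylvester f g m n (σ j) j).natDegree ≤
        ∑ j, (sylvester f g m n (σ j) j).natDegree := natDegree_prod_le _ _
    have h2 := Finset.sum_le_sum fun j (_ : j ∈ Finset.univ) => hentry (σ j) j (h0 j)
    rw [Finset.sum_add_distrib, Equiv.sum_comp σ (fun j : Fin (m + n) => (j : ℕ))] at h2
    have h3 : (Equiv.Perm.sign σ • ∏ j, sylvester f g m n (σ j) j).natDegree ≤
        (∏ j, sylvester f g m n (σ j) j).natDegree := by
      rcases Int.units_eq_one_or (Equiv.Perm.sign σ) with h | h <;> simp [h]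
    omega
  · push Not at h0
    obtain ⟨j, hj⟩ := h0
    have h1 : ∏ i, sylvester f g m n (σ i) i = 0 := Finset.prod_eq_zero (Finset.mem_univ j) hj
    simp [h1]

end Polynomial

/-! ### Bivariate polynomials and their partial derivatives. -/

namespace Polynomial

/-- A bivariate polynomial, regarded as a polynomial in `y` with coefficients in `R[x]`, has total
degree at most `k`. -/
def TotalDegreeLE {R : Type*} [CommRing R] (f : R[X][X]) (k : ℕ) : Prop :=
  ∀ i, f.coeff i ≠ 0 → (f.coeff i).natDegree + i ≤ k

namespace TotalDegreeLE

variable {R : Type*} [CommRing R] {f : R[X][X]} {k : ℕ}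

theorem natDegree_le (hf : f.TotalDegreeLE k) : f.natDegree ≤ k := by
  by_cases h0 : f = 0
  · simp [h0]
  · have := hf f.natDegree (by simpa using h0)
    omega

theorem derivative (hf : f.TotalDegreeLE k) : (derivative f).TotalDegreeLE (k - 1) := by
  intro i hi
  rw [coeff_derivative] at hi ⊢
  have h1 := hf (i + 1) (left_ne_zero_of_mul hi)
  have h2 : (f.coeff (i + 1) * ((i : R[X]) + 1)).natDegree ≤ (f.coeff (i + 1)).natDegree := by
    refine natDegree_mul_le.trans ?_
    rw [← Nat.cast_succ, natDegree_natCast, add_zero]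
  omega

end TotalDegreeLE

/-- The partial derivative of a bivariate polynomial with respect to the inner variable. -/
noncomputable def coeffDerivative {R : Type*} [CommRing R] (f : R[X][X]) : R[X][X] :=
  PolynomialModule.equivPolynomialSelf (derivative'.mapCoeffs f)

section coeffDerivative

variable {R : Type*} [CommRing R]

@[simp]
theorem coeff_coeffDerivative (f : R[X][X]) (i : ℕ) :
    f.coeffDerivative.coeff i = derivative (f.coeff i) :=
  rfl

theorem coeffDerivative_add (f g : R[X][X]) :
    (f + g).coeffDerivative = f.coeffDerivative + g.coeffDerivative := by
  ext1 i; simp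

theorem coeffDerivative_monomial (n : ℕ) (a : R[X]) :
    (monomial n a).coeffDerivative = monomial n (derivative a) := by
  ext1 i
  rw [coeff_coeffDerivative, coeff_monomial, coeff_monomial]
  split_ifs <;> simp

theorem TotalDegreeLE.coeffDerivative {f : R[X][X]} {k : ℕ} (hf : f.TotalDegreeLE k) :
    f.coeffDerivative.TotalDegreeLE (k - 1) := by
  intro i hi
  rw [coeff_coeffDerivative] at hi ⊢
  have h1 := hf i (by rintro h; simp [h] at hi)
  have h2 : (f.coeff i).natDegree ≠ 0 := by
    intro h
    rw [eq_C_of_natDegree_eq_zero h] at hi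
    simp at hi
  have h3 := natDegree_derivative_lt h2
  omega

/-- The chain rule for `f(x, g(x))`. -/
theorem derivative_eval₂_coe (f : R[X][X]) (g : PowerSeries R) :
    PowerSeries.derivative R (f.eval₂ coeToPowerSeries.ringHom g) =
      f.coeffDerivative.eval₂ coeToPowerSeries.ringHom g +
        (derivative f).eval₂ coeToPowerSeries.ringHom g * PowerSeries.derivative R g := by
  induction f using Polynomial.induction_on' with
  | add p q hp hq =>
    simp only [eval₂_add, map_add, coeffDerivative_add, hp, hq]
    ring
  | monomial n a =>
    simp only [coeffDerivative_monomial, derivative_monomial, eval₂_monomial, Derivation.leibniz,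
      Derivation.leibniz_pow, coeToPowerSeries.ringHom_apply, PowerSeries.derivative_coe,
      smul_eq_mul, nsmul_eq_mul, coe_mul, ← map_natCast (coeToPowerSeries.ringHom (R := R)),
      coeToPowerSeries.ringHom_apply]
    ring

end coeffDerivative

/-! ### Resultants, separability and approximate roots of irreducible relations. -/

variable {F : Type*} [Field F]

theorem le_natDegree_of_X_pow_dvd_coe {p : F[X]} (hp : p ≠ 0) {n : ℕ}
    (h : (PowerSeries.X : PowerSeries F) ^ n ∣ coeToPowerSeries.ringHom p) :
    n ≤ p.natDegree := by
  by_contra! hlt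
  have := PowerSeries.X_pow_dvd_iff.1 h _ hlt
  rw [coeToPowerSeries.ringHom_apply, coeff_coe] at this
  exact hp (leadingCoeff_eq_zero.1 this)

/-- By Gauss's lemma `f` stays irreducible over the fraction field, hence coprime to `g`. A formal
degree `n` above that of `g` only adds powers of the leading coefficient of `f`; this matters
because `derivative f` can drop degree in characteristic `p`. -/
theorem resultant_ne_zero_of_irreducible {f g : F[X][X]} (hf : Irreducible f)
    (hf0 : f.natDegree ≠ 0) (hfg : ¬ f ∣ g) {n : ℕ} (hn : g.natDegree ≤ n) :
    resultant f g f.natDegree n ≠ 0 := by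
  obtain ⟨j, rfl⟩ := Nat.exists_eq_add_of_le hn
  have hprim := hf.isPrimitive hf0
  rw [resultant_add_right_deg _ _ _ _ _ le_rfl]
  refine mul_ne_zero (pow_ne_zero _ (by simpa using hf.ne_zero)) fun h0 => ?_
  have hinj := FaithfulSMul.algebraMap_injective F[X] (FractionRing F[X])
  have h1 := congrArg (algebraMap F[X] (FractionRing F[X])) h0
  rw [map_zero, ← resultant_map_map, ← natDegree_map_eq_of_injective hinj f,
    ← natDegree_map_eq_of_injective hinj g, resultant_eq_zero_iff] at h1
  refine h1.2 (((hprim.irreducible_iff_irreducible_map_fraction_map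
    (K := FractionRing F[X])).1 hf).coprime_iff_not_dvd.2 fun h2 => hfg ?_)
  exact hprim.dvd_of_fraction_map_dvd_fraction_map h2

/-- A Bézout bound: the resultant is a combination of `f` and `g`, so it is a nonzero polynomial in
`x` divisible by `x^n`, of degree at most `k * l`. -/
theorem le_mul_of_X_pow_dvd_eval₂ {f g : F[X][X]} (hf : Irreducible f) (hf0 : f.natDegree ≠ 0)
    (hfg : ¬ f ∣ g) {k l n : ℕ} (hk : f.TotalDegreeLE k) (hl : g.TotalDegreeLE l)
    {s : PowerSeries F}
    (hfs : (PowerSeries.X : PowerSeries F) ^ n ∣ f.eval₂ coeToPowerSeries.ringHom s)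
    (hgs : (PowerSeries.X : PowerSeries F) ^ n ∣ g.eval₂ coeToPowerSeries.ringHom s) :
    n ≤ k * l := by
  have hne := resultant_ne_zero_of_irreducible hf hf0 hfg le_rfl
  obtain ⟨p, q, -, -, hpq⟩ := exists_mul_add_mul_eq_C_resultant f g le_rfl le_rfl (.inl hf0)
  have h1 := congrArg (eval₂ coeToPowerSeries.ringHom s) hpq
  rw [eval₂_add, eval₂_mul, eval₂_mul, eval₂_C] at h1
  have h2 := le_natDegree_of_X_pow_dvd_coe hne
    (h1 ▸ dvd_add (Dvd.dvd.mul_right hfs _) (Dvd.dvd.mul_right hgs _))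
  refine h2.trans ((natDegree_resultant_le hk hl).trans ?_)
  obtain ⟨a, rfl⟩ := Nat.exists_eq_add_of_le hk.natDegree_le
  obtain ⟨b, rfl⟩ := Nat.exists_eq_add_of_le hl.natDegree_le
  rw [Nat.sub_le_iff_le_add]
  nlinarith [Nat.zero_le (a * b)]

/-- If both partial derivatives vanish, `f` is a polynomial in `x^p` and `y^p`; its coefficients are
`p`th powers, so `f` is itself a `p`th power. -/
theorem coeffDerivative_ne_zero_of_irreducible (p : ℕ) [hp : Fact p.Prime] [CharP F p]
    [PerfectRing F p] {f : F[X][X]} (hf : Irreducible f)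
    (h : derivative f = 0) : f.coeffDerivative ≠ 0 := by
  intro h'
  have hroot : ∀ i, ∃ c : F[X], (contract p f).coeff i = c ^ p := by
    intro i
    have h1 : derivative ((contract p f).coeff i) = 0 := by
      rw [coeff_contract (expChar_pos F p).ne', ← coeff_coeffDerivative, h', coeff_zero]
    obtain ⟨c, hc⟩ := Polynomial.map_surjective (frobenius F p) (surjective_frobenius F p)
      (contract p ((contract p f).coeff i))
    refine ⟨c, ?_⟩
    rw [← map_frobenius_expand, map_expand, hc, expand_contract' p h1]
  choose c hc using hroot
  have hlift : contract p f ∈ lifts (frobenius F[X] p) := by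
    rw [lifts_iff_coeff_lifts]
    exact fun i => ⟨c i, (hc i).symm⟩
  obtain ⟨b, hb⟩ := (mem_lifts _).1 hlift
  have hfb : f = b ^ p := by
    rw [← map_frobenius_expand, map_expand, hb, expand_contract' p h]
  exact not_irreducible_pow hp.out.ne_one (hfb ▸ hf)

/-- An irreducible polynomial relation that holds to high order is separable in `y`. -/
theorem derivative_ne_zero_of_X_pow_dvd [Finite F] {f : F[X][X]} (hf : Irreducible f)
    (hf0 : f.natDegree ≠ 0) {k n : ℕ} (hk : f.TotalDegreeLE k) (hn : k * (k - 1) + 1 < n)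
    {s : PowerSeries F}
    (hs : (PowerSeries.X : PowerSeries F) ^ n ∣ f.eval₂ coeToPowerSeries.ringHom s) :
    derivative f ≠ 0 := by
  intro h
  obtain ⟨p, hp⟩ := CharP.exists F
  have : Fact p.Prime := ⟨CharP.char_is_prime F p⟩
  have hne := coeffDerivative_ne_zero_of_irreducible p hf h
  -- A quotient would lie in `F[x]`, and then the leading coefficient in `y` would divide its own
  -- nonzero derivative, of smaller degree.
  have hnd : ¬ f ∣ f.coeffDerivative := by
    rintro ⟨g, hg⟩
    rw [hg] at hne
    have hg0 : g = C (g.coeff 0) := by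
      refine eq_C_of_natDegree_eq_zero ?_
      have h1 : f.coeffDerivative.natDegree ≤ f.natDegree := by
        refine natDegree_le_iff_coeff_eq_zero.2 fun i hi => ?_
        rw [coeff_coeffDerivative, coeff_eq_zero_of_natDegree_lt hi, map_zero]
      rw [hg, natDegree_mul (left_ne_zero_of_mul hne) (right_ne_zero_of_mul hne)] at h1
      omega
    have h2 := congrArg (fun q => q.coeff f.natDegree) hg
    rw [hg0] at h2 hne
    simp only [coeff_coeffDerivative, coeff_mul_C] at h2
    have h3 : f.coeff f.natDegree ≠ 0 := by simpa using hf.ne_zero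
    have h4 : g.coeff 0 ≠ 0 := by simpa using right_ne_zero_of_mul hne
    have h5 := degree_derivative_lt h3
    rw [h2, degree_mul] at h5
    exact absurd h5 (not_lt.2 (le_add_of_nonneg_right (zero_le_degree_iff.2 h4)))
  -- As `f_y = 0`, differentiating `f(x, s)` leaves `f_x(x, s)`, which loses one order; the Bézout
  -- bound then forces `n - 1 ≤ k(k-1)`.
  have h1 := derivative_eval₂_coe f s
  rw [h, eval₂_zero, zero_mul, add_zero] at h1
  have h2 : (PowerSeries.X : PowerSeries F) ^ (n - 1) ∣
      f.coeffDerivative.eval₂ coeToPowerSeries.ringHom s := by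
    rw [← h1, PowerSeries.X_pow_dvd_iff]
    intro m hm
    rw [PowerSeries.coeff_derivative, PowerSeries.X_pow_dvd_iff.1 hs _ (by omega), zero_mul]
  have := le_mul_of_X_pow_dvd_eval₂ hf hf0 hnd hk hk.coeffDerivative
    ((pow_dvd_pow _ (Nat.sub_le n 1)).trans hs) h2
  omega

/-- The square of the derivative at a root divides the discriminant. -/
theorem sq_eval_derivative_dvd_resultant {A : Type*} [CommRing A] [IsDomain A] {f : A[X]} {r : A}
    (hr : f.IsRoot r) (hf : 2 ≤ f.natDegree) :
    (derivative f).eval r ^ 2 ∣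
      resultant f (derivative f) f.natDegree (f.natDegree - 1) := by
  obtain ⟨g, rfl⟩ := dvd_iff_isRoot.2 hr
  have hg0 : g ≠ 0 := by rintro rfl; simp at hf
  have hdeg : ((X - C r) * g).natDegree = 1 + g.natDegree := by
    rw [natDegree_mul (X_sub_C_ne_zero r) hg0, natDegree_X_sub_C]
  have hd : derivative ((X - C r) * g) = (X - C r) * derivative g + g * 1 := by
    simp; ring
  have hev : (derivative ((X - C r) * g)).eval r = g.eval r := by simp
  have hdd : (derivative ((X - C r) * g)).natDegree ≤ g.natDegree := by
    have := natDegree_derivative_le ((X - C r) * g)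
    omega
  rw [hdeg] at hf ⊢
  rw [Nat.add_sub_cancel_left]
  -- One factor `f'(r) = g(r)` comes from the root `r`; the other from `Res(g, (X - r)g')`, a
  -- combination of `g` and `(X - r)g'` evaluated at `r`.
  have hmul := resultant_mul_left (X - C r) g (derivative ((X - C r) * g)) g.natDegree hdd
  rw [natDegree_X_sub_C, resultant_X_sub_C_left _ _ _ hdd] at hmul
  rw [hmul, sq]
  refine mul_dvd_mul_left _ ?_
  rw [hev, hd, resultant_add_mul_right _ _ _ _ _ (by simp) le_rfl]
  have hwd : ((X - C r) * derivative g).natDegree ≤ g.natDegree := by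
    have h1 := natDegree_mul_le (p := X - C r) (q := derivative g)
    rw [natDegree_X_sub_C] at h1
    have h2 := natDegree_derivative_le g
    omega
  obtain ⟨p, q, -, -, hpq⟩ := exists_mul_add_mul_eq_C_resultant g ((X - C r) * derivative g)
    le_rfl hwd (.inl (by omega))
  have h1 := congrArg (eval r) hpq
  simp only [eval_add, eval_mul, eval_sub, eval_X, eval_C, sub_self, zero_mul, add_zero] at h1
  exact ⟨_, h1.symm⟩

theorem not_X_pow_dvd_eval₂_derivative [Finite F] {f : F[X][X]} (hf : Irreducible f)
    (hf0 : f.natDegree ≠ 0) {k n : ℕ} (hk : f.TotalDegreeLE k) (hn : k * (k - 1) + 1 < n)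
    {s : PowerSeries F}
    (hs : (PowerSeries.X : PowerSeries F) ^ n ∣ f.eval₂ coeToPowerSeries.ringHom s) :
    ¬ (PowerSeries.X : PowerSeries F) ^ (k * (k - 1) / 2 + 1) ∣
      (derivative f).eval₂ coeToPowerSeries.ringHom s := by
  intro hdvd
  set ι := coeToPowerSeries.ringHom (R := F)
  set e := k * (k - 1) / 2 + 1
  have hι : Function.Injective ι := coe_injective F
  have hd0 := derivative_ne_zero_of_X_pow_dvd hf hf0 hk hn hs
  have hdd := natDegree_derivative_le f
  have hfd : ¬ f ∣ derivative f := fun h => by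
    have := natDegree_le_of_dvd h hd0
    omega
  have hne := resultant_ne_zero_of_irreducible hf hf0 hfd hdd
  have hle := natDegree_resultant_le (m := f.natDegree) (n := f.natDegree - 1) hk hk.derivative
  have hmk := hk.natDegree_le
  -- In the linear case `f_y` is a polynomial in `x` alone and is bounded directly.
  rcases (show f.natDegree = 1 ∨ 2 ≤ f.natDegree by omega) with h1 | h2
  · have hcoef : (derivative f).eval₂ ι s = ι ((derivative f).coeff 0) := by
      rw [eq_C_of_natDegree_eq_zero (show (derivative f).natDegree = 0 by omega)]
      simp
    have h3 := le_natDegree_of_X_pow_dvd_coe (n := e) (p := (derivative f).coeff 0)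
      (by
        rw [eq_C_of_natDegree_eq_zero (show (derivative f).natDegree = 0 by omega)] at hd0
        simpa using hd0) (hcoef ▸ hdvd)
    have h4 := hk.derivative 0 (by
        rw [eq_C_of_natDegree_eq_zero (show (derivative f).natDegree = 0 by omega)] at hd0
        simpa using hd0)
    have h5 : k - 1 ≤ k * (k - 1) / 2 := by
      rw [Nat.le_div_iff_mul_le two_pos]
      rcases (show k = 1 ∨ 2 ≤ k by omega) with rfl | h
      · simp
      · rw [mul_comm]; exact Nat.mul_le_mul_right _ h
    omega
  · have hdle : (resultant f (derivative f) f.natDegree (f.natDegree - 1)).natDegree ≤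
        k * (k - 1) := by
      refine hle.trans ?_
      obtain ⟨a, ha⟩ := Nat.exists_eq_add_of_le hmk
      obtain ⟨b, hb⟩ := Nat.exists_eq_add_of_le' (show 1 ≤ f.natDegree by omega)
      have hk1 : k - 1 = b + a := by omega
      rw [hk1, ha, hb, Nat.add_sub_cancel, Nat.sub_le_iff_le_add]
      -- The slack is exactly `(k - deg_y f)²`.
      nlinarith [Nat.zero_le (a * a)]
    have hX : (PowerSeries.X : PowerSeries F) ^ (k * (k - 1) + 1) ∣
        ι (resultant f (derivative f) f.natDegree (f.natDegree - 1)) := by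
      set φ := f.map ι with hφ
      have hφe : φ.eval s = f.eval₂ ι s := by rw [hφ, eval_map]
      have hφd : (derivative φ).eval s = (derivative f).eval₂ ι s := by
        rw [hφ, derivative_map, eval_map]
      -- Subtracting the small value at `s` makes `s` an exact root without changing the derivative,
      -- and alters the discriminant only modulo the relevant power of `X`.
      set ψ := φ - C (φ.eval s) with hψ
      have hψd : derivative ψ = derivative φ := by simp [hψ]
      have hψn : ψ.natDegree = f.natDegree := by
        rw [hψ, natDegree_sub_C, hφ, natDegree_map_eq_of_injective hι]
      have hsq := sq_eval_derivative_dvd_resultant (f := ψ) (r := s) (by simp [hψ, IsRoot])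
        (by omega)
      rw [hψd, hψn, hφd] at hsq
      have h3 : (PowerSeries.X : PowerSeries F) ^ (k * (k - 1) + 1) ∣
          resultant ψ (derivative φ) f.natDegree (f.natDegree - 1) := by
        have h4 := (pow_dvd_pow_of_dvd hdvd 2).trans hsq
        rw [← pow_mul] at h4
        exact (pow_dvd_pow _ (by omega)).trans h4
      have h4 : (PowerSeries.X : PowerSeries F) ^ (k * (k - 1) + 1) ∣
          resultant φ (derivative φ) f.natDegree (f.natDegree - 1) -
            resultant ψ (derivative φ) f.natDegree (f.natDegree - 1) := by
        rw [← Ideal.mem_span_singleton, ← Ideal.Quotient.mk_eq_mk_iff_sub_mem,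
          ← resultant_map_map, ← resultant_map_map]
        congr 1
        have h5 : (Ideal.Quotient.mk (Ideal.span {(PowerSeries.X : PowerSeries F) ^
            (k * (k - 1) + 1)})) (φ.eval s) = 0 := by
          rw [Ideal.Quotient.eq_zero_iff_mem, Ideal.mem_span_singleton, hφe]
          exact (pow_dvd_pow _ (by omega)).trans hs
        rw [hψ, Polynomial.map_sub, map_C, h5, C_0, sub_zero]
      have h6 := dvd_add h4 h3
      rw [sub_add_cancel] at h6
      rwa [← resultant_map_map, ← derivative_map]
    have := le_natDegree_of_X_pow_dvd_coe hne hX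
    omega

/-- A power series that satisfies an irreducible polynomial relation to high order lies close to
a root of that relation. -/
theorem exists_root_of_irreducible [Finite F] {f : F[X][X]} (hf : Irreducible f)
    {k n : ℕ} (hk : f.TotalDegreeLE k) (hn : k ^ 2 < n) {s : PowerSeries F}
    (hs : (PowerSeries.X : PowerSeries F) ^ n ∣ f.eval₂ coeToPowerSeries.ringHom s) :
    ∃ r ∈ (f.map coeToPowerSeries.ringHom).roots,
      (PowerSeries.X : PowerSeries F) ^ (n - k * (k - 1) / 2) ∣ r - s := by
  have hι : Function.Injective (coeToPowerSeries.ringHom (R := F)) := coe_injective F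
  have hkk : k * (k - 1) + k = k ^ 2 := by cases k <;> simp; ring
  have hf0 : f.natDegree ≠ 0 := by
    intro h0
    rw [eq_C_of_natDegree_eq_zero h0, eval₂_C] at hs
    have hc : f.coeff 0 ≠ 0 := by
      have := hf.ne_zero
      rw [eq_C_of_natDegree_eq_zero h0] at this
      simpa using this
    have h1 := le_natDegree_of_X_pow_dvd_coe hc hs
    have h2 := hk 0 hc
    have h3 : k ≤ k ^ 2 := Nat.le_self_pow two_ne_zero k
    omega
  have hk0 := hk.natDegree_le
  have h1 := not_X_pow_dvd_eval₂_derivative hf hf0 hk (by omega) hs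
  rw [← eval_map, ← derivative_map] at h1
  rw [← eval_map] at hs
  obtain ⟨r, hr, hrs⟩ := PowerSeries.exists_root_of_X_pow_dvd _ s (by omega) hs h1
  exact ⟨r, (mem_roots fun h => hf.ne_zero ((Polynomial.map_eq_zero_iff hι).1 h)).2 hr, hrs⟩

end Polynomial

/-! ### Passage from `MvPolynomial`, and counting by total degree. -/

namespace Polynomial

theorem totalDegreeLE_equivMvPolynomial_symm {R : Type*} [CommRing R]
    (p : MvPolynomial (Fin 2) R) :
    ((Bivariate.equivMvPolynomial R).symm p).TotalDegreeLE p.totalDegree := by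
  have key : ∀ i j, p.totalDegree < j + i →
      (((Bivariate.equivMvPolynomial R).symm p).coeff i).coeff j = 0 := by
    intro i j hij
    conv_lhs => rw [p.as_sum]
    rw [map_sum, finsetSum_coeff, finsetSum_coeff]
    refine Finset.sum_eq_zero fun d hd => ?_
    have hd' : d 0 + d 1 ≤ p.totalDegree := by
      have := MvPolynomial.le_totalDegree hd
      rwa [Finsupp.sum_fintype _ _ (by simp), Fin.sum_univ_two] at this
    have h1 : (Bivariate.equivMvPolynomial R).symm (MvPolynomial.monomial d (p.coeff d)) =
        monomial (d 1) (monomial (d 0) (p.coeff d)) := by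
      rw [MvPolynomial.monomial_eq, Finsupp.prod_fintype _ _ (by simp), Fin.prod_univ_two]
      simp only [map_mul, map_pow, Bivariate.equivMvPolynomial_symm_C,
        Bivariate.equivMvPolynomial_symm_X_0, Bivariate.equivMvPolynomial_symm_X_1]
      rw [← C_mul_X_pow_eq_monomial, ← C_mul_X_pow_eq_monomial, C_mul, C_pow, mul_assoc]
    rw [h1, coeff_monomial]
    split_ifs with h
    · rw [coeff_monomial, if_neg (by omega)]
    · simp
  intro i hi
  by_contra! hlt
  exact hi (leadingCoeff_eq_zero.1 (key i _ hlt))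

theorem eval₂_equivMvPolynomial_symm {R : Type*} [CommRing R] (p : MvPolynomial (Fin 2) R)
    (s : PowerSeries R) :
    ((Bivariate.equivMvPolynomial R).symm p).eval₂ coeToPowerSeries.ringHom s =
      MvPolynomial.aeval ![(PowerSeries.X : PowerSeries R), s] p := by
  induction p using MvPolynomial.induction_on with
  | C a => simp
  | add p q hp hq => simp [eval₂_add, hp, hq]
  | mul_X p i hp =>
    rw [map_mul, eval₂_mul, hp, map_mul]
    fin_cases i <;> simp

theorem finite_and_card_totalDegreeLE_le (F : Type*) [Field F] [Fintype F] (k : ℕ) :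
    Finite {f : F[X][X] // f.TotalDegreeLE k} ∧
      Nat.card {f : F[X][X] // f.TotalDegreeLE k} ≤
        Fintype.card F ^ ((k + 1) * (k + 2) / 2) := by
  let c : {f : F[X][X] // f.TotalDegreeLE k} → ((i : Fin (k + 1)) × Fin (i + 1)) → F :=
    fun f ij => (f.1.coeff ij.2).coeff (ij.1 - ij.2)
  have hc : Function.Injective c := by
    rintro ⟨f, hf⟩ ⟨g, hg⟩ hfg
    have hzero : ∀ h : F[X][X], h.TotalDegreeLE k → ∀ i j, k < i + j →
        (h.coeff i).coeff j = 0 := by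
      intro h hh i j hij
      by_contra h0
      have h1 := hh i (by rintro h1; simp [h1] at h0)
      have h2 := le_natDegree_of_ne_zero h0
      omega
    ext i j
    by_cases hij : i + j ≤ k
    · have := congrFun hfg ⟨⟨i + j, by omega⟩, ⟨i, by simp⟩⟩
      simpa [c] using this
    · rw [hzero f hf i j (by omega), hzero g hg i j (by omega)]
  refine ⟨Finite.of_injective c hc, (Nat.card_le_card_of_injective c hc).trans_eq ?_⟩
  rw [Nat.card_eq_fintype_card, Fintype.card_fun, Fintype.card_sigma]
  congr 1
  simp only [Fintype.card_fin]
  rw [Fin.sum_univ_eq_sum_range (fun i => i + 1) (k + 1)]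
  have h1 := Finset.sum_range_succ' (fun i => i) (k + 1)
  have h2 := Finset.sum_range_id_mul_two (k + 1 + 1)
  simp only [Nat.add_sub_cancel, add_zero] at h1 h2
  rw [← h1, mul_comm (k + 1), ← h2, Nat.mul_div_cancel _ two_pos]

end Polynomial

/-- Some irreducible factor of a polynomial relation has order at least proportional to its
degree. -/
theorem exists_irreducible_dvd_of_X_pow_dvd_aeval {F : Type*} [Field F] (s : PowerSeries F)
    {t : ℝ} (ht : 0 ≤ t) (h : MvPolynomial (Fin 2) F) (h0 : h ≠ 0) (n : ℕ)
    (hs : (PowerSeries.X : PowerSeries F) ^ n ∣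
      MvPolynomial.aeval ![(PowerSeries.X : PowerSeries F), s] h)
    (hn : t * h.totalDegree < n) :
    ∃ p, Irreducible p ∧ p ∣ h ∧ (PowerSeries.X : PowerSeries F) ^ ⌈t * p.totalDegree⌉₊ ∣
      MvPolynomial.aeval ![(PowerSeries.X : PowerSeries F), s] p := by
  induction h using WfDvdMonoid.induction_on_irreducible generalizing n with
  | zero => exact absurd rfl h0
  | unit u hu =>
    have hu' := isUnit_of_dvd_unit hs (hu.map _)
    rcases Nat.eq_zero_or_pos n with rfl | hpos
    · rw [Nat.cast_zero] at hn
      exact absurd hn (not_lt.2 (by positivity))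
    · exact absurd ((isUnit_pow_iff hpos.ne').1 hu') PowerSeries.X_prime.not_isUnit
  | mul a p ha hp ih =>
    by_cases hps : (PowerSeries.X : PowerSeries F) ^ ⌈t * p.totalDegree⌉₊ ∣
      MvPolynomial.aeval ![(PowerSeries.X : PowerSeries F), s] p
    · exact ⟨p, hp, dvd_mul_right _ _, hps⟩
    -- If `p` has order `e < t * deg p`, cancelling `X^e` leaves `a` with order above `t * deg a`.
    · have hpos : ⌈t * p.totalDegree⌉₊ ≠ 0 := by rintro h; simp [h] at hps
      obtain ⟨d, hd⟩ := Nat.exists_eq_succ_of_ne_zero hpos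
      rw [hd] at hps
      obtain ⟨e, he, u, hu, hpu⟩ := PowerSeries.exists_eq_X_pow_mul_isUnit hps
      have het : (e : ℝ) < t * p.totalDegree := Nat.lt_ceil.1 (by omega)
      rw [MvPolynomial.totalDegree_mul_of_isDomain hp.ne_zero ha, Nat.cast_add, mul_add] at hn
      have hen : e ≤ n := by
        have : (e : ℝ) ≤ n := by
          have : 0 ≤ t * (a.totalDegree : ℝ) := by positivity
          linarith
        exact_mod_cast this
      obtain ⟨m, rfl⟩ := Nat.exists_eq_add_of_le hen
      rw [map_mul, hpu, pow_add, mul_assoc,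
        mul_dvd_mul_iff_left (pow_ne_zero _ PowerSeries.X_ne_zero), hu.dvd_mul_left] at hs
      obtain ⟨q, hq, hqa, hqs⟩ := ih ha m hs (by push_cast at hn; linarith)
      exact ⟨q, hq, hqa.mul_left p, hqs⟩

/-! ### Union bound over irreducible relations and their roots. -/

section Probability

variable {F : Type*} [Field F] [Fintype F] [MeasurableSpace F] [MeasurableSingletonClass F]

theorem uniformSequenceMeasure_X_pow_dvd_sub_le (r : PowerSeries F) (n : ℕ) :
    uniformSequenceMeasure F {S | (PowerSeries.X : PowerSeries F) ^ n ∣ r - generatingFunction S} ≤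
      (Fintype.card F : ENNReal)⁻¹ ^ n := by
  have hsub : {S | (PowerSeries.X : PowerSeries F) ^ n ∣ r - generatingFunction S} ⊆
      Set.pi (Finset.range n) fun i => {PowerSeries.coeff i r} := by
    intro S hS i hi
    have := PowerSeries.X_pow_dvd_iff.1 hS i (by simpa using hi)
    rw [map_sub, sub_eq_zero, generatingFunction, PowerSeries.coeff_mk] at this
    simp [this]
  refine (measure_mono hsub).trans_eq ?_
  rw [uniformSequenceMeasure, Measure.infinitePi_pi _ fun i _ => measurableSet_singleton _]
  simp only [uniformMeasure, PMF.toMeasure_apply_singleton _ _ (measurableSet_singleton _),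
    PMF.uniformOfFintype_apply, Finset.prod_const, Finset.card_range]

/-- The sequences whose generating function satisfies some irreducible polynomial relation of
total degree at most `k` to order `n`. -/
def relationEvent (F : Type*) [Field F] (k n : ℕ) : Set (ℕ → F) :=
  {S | ∃ f : Polynomial (Polynomial F), Irreducible f ∧ f.TotalDegreeLE k ∧
    (PowerSeries.X : PowerSeries F) ^ n ∣
      f.eval₂ Polynomial.coeToPowerSeries.ringHom (generatingFunction S)}

theorem uniformSequenceMeasure_relationEvent_le {k n : ℕ} (hn : k ^ 2 < n) :
    uniformSequenceMeasure F (relationEvent F k n) ≤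
      (Fintype.card F : ENNReal) ^ ((k + 1) * (k + 2) / 2) *
        (k * (Fintype.card F : ENNReal)⁻¹ ^ (n - k * (k - 1) / 2)) := by
  classical
  obtain ⟨hfin, hcard⟩ := Polynomial.finite_and_card_totalDegreeLE_le F k
  have := Fintype.ofFinite {f : Polynomial (Polynomial F) // f.TotalDegreeLE k}
  have hsub : relationEvent F k n ⊆
      ⋃ f : {f : Polynomial (Polynomial F) // f.TotalDegreeLE k},
        ⋃ r ∈ (f.1.map Polynomial.coeToPowerSeries.ringHom).roots.toFinset,
          {S | (PowerSeries.X : PowerSeries F) ^ (n - k * (k - 1) / 2) ∣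
            r - generatingFunction S} := by
    rintro S ⟨f, hf, hk, hs⟩
    obtain ⟨r, hr, hrs⟩ := Polynomial.exists_root_of_irreducible hf hk hn hs
    simp only [Set.mem_iUnion]
    exact ⟨⟨f, hk⟩, r, Multiset.mem_toFinset.2 hr, hrs⟩
  refine (measure_mono hsub).trans ((measure_iUnion_fintype_le _ _).trans ?_)
  refine (Finset.sum_le_sum fun f _ => (measure_biUnion_finset_le _ _).trans <|
    Finset.sum_le_sum fun r _ => uniformSequenceMeasure_X_pow_dvd_sub_le r _).trans ?_
  simp only [Finset.sum_const, nsmul_eq_mul]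
  refine (Finset.sum_le_sum (g := fun _ => (k : ENNReal) *
    (Fintype.card F : ENNReal)⁻¹ ^ (n - k * (k - 1) / 2)) fun f _ => ?_).trans ?_
  · gcongr
    exact (Multiset.toFinset_card_le _).trans ((Polynomial.card_roots' _).trans
      (Polynomial.natDegree_map_le.trans f.2.natDegree_le))
  · rw [Finset.sum_const, nsmul_eq_mul, Finset.card_univ, ← Nat.card_eq_fintype_card]
    gcongr
    exact_mod_cast hcard

theorem uniformSequenceMeasure_relationEvent_le_two_pow {k n : ℕ} (hn : k ^ 2 + k + 1 ≤ n) :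
    uniformSequenceMeasure F (relationEvent F k n) ≤ k * 2⁻¹ ^ (n - (k ^ 2 + k + 1)) := by
  refine (uniformSequenceMeasure_relationEvent_le (by omega)).trans ?_
  have hq : (2 : ENNReal) ≤ Fintype.card F := by exact_mod_cast Fintype.one_lt_card
  -- The part `(k+1)(k+2)/2` cancels the number of polynomials.
  have hexp : n - k * (k - 1) / 2 = (n - (k ^ 2 + k + 1)) + (k + 1) * (k + 2) / 2 := by
    have h1 : k * (k - 1) / 2 * 2 = k * (k - 1) :=
      Nat.div_mul_cancel (Nat.even_mul_pred_self k).two_dvd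
    have h2 : (k + 1) * (k + 2) / 2 * 2 = (k + 1) * (k + 2) :=
      Nat.div_mul_cancel (Nat.even_mul_succ_self (k + 1)).two_dvd
    have h3 : k * (k - 1) + (k + 1) * (k + 2) = 2 * (k ^ 2 + k + 1) := by
      cases k <;> simp; ring
    omega
  rw [hexp, pow_add, mul_left_comm, mul_left_comm _ (_ ^ _) (_ ^ _), ← mul_pow,
    ENNReal.mul_inv_cancel (by positivity) (by simp), one_pow, mul_one]
  gcongr

end Probability

/-! ### Reduction of low complexity to irreducible relations, with summable bounds. -/

theorem summable_sq_mul_exp_neg_mul_sqrt {a : ℝ} (ha : 0 < a) :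
    Summable fun N : ℕ => (N : ℝ) ^ 2 * Real.exp (-a * Real.sqrt N) := by
  -- Exponent `-8` in `√N` is `N^(-4)`, leaving `N^(-2)` after the factor `N^2`.
  have h1 := ((isLittleO_exp_neg_mul_rpow_atTop ha (-8)).comp_tendsto
    (Real.tendsto_sqrt_atTop.comp tendsto_natCast_atTop_atTop)).isBigO
  have h2 := (Asymptotics.isBigO_refl (fun N : ℕ => (N : ℝ) ^ 2) atTop).mul h1
  refine summable_of_isBigO_nat ?_ h2
  refine (Real.summable_nat_rpow.2 (by norm_num : (-2 : ℝ) < -1)).congr fun N => ?_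
  rcases Nat.eq_zero_or_pos N with rfl | hN
  · norm_num
  · have hN' : (0 : ℝ) < N := by exact_mod_cast hN
    simp only [Function.comp_apply]
    rw [Real.sqrt_eq_rpow, ← Real.rpow_mul hN'.le, ← Real.rpow_natCast, ← Real.rpow_add hN']
    norm_num

theorem exists_isExpansionRelation_of_expansionComplexity_lt {F : Type*} [Field F] (S : ℕ → F)
    (N : ℕ) {b : ℝ} (hb : 1 < b) (h : (expansionComplexity S N : ℝ) < b) :
    ∃ p, IsExpansionRelation S N p ∧ (p.totalDegree : ℝ) < b := by
  unfold expansionComplexity at h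
  split_ifs at h with h0
  -- In the convention case `E_N = 0` the relation `y` has degree `1 < b`.
  · refine ⟨MvPolynomial.X 1, ⟨MvPolynomial.X_ne_zero 1, ?_⟩, ?_⟩
    · rw [PowerSeries.X_pow_dvd_iff]
      intro i hi
      simpa [generatingFunction] using h0 i hi
    · simpa using hb
  · have hne : {d : ℕ | ∃ h : MvPolynomial (Fin 2) F,
        IsExpansionRelation S N h ∧ h.totalDegree = d}.Nonempty := by
      obtain ⟨p, hp⟩ := exists_isExpansionRelation S N
      exact ⟨_, p, hp, rfl⟩
    obtain ⟨p, hp, hpd⟩ := Nat.sInf_mem hne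
    exact ⟨p, hp, hpd ▸ h⟩

theorem setOf_expansionComplexity_lt_subset {F : Type*} [Field F] {c : ℝ} (hc : 0 < c)
    {N : ℕ} (hN : 1 < c * Real.sqrt N) :
    {S : ℕ → F | (expansionComplexity S N : ℝ) < c * Real.sqrt N} ⊆
      ⋃ k ∈ Finset.Icc 1 ⌊c * Real.sqrt N⌋₊, relationEvent F k ⌈Real.sqrt N / c * k⌉₊ := by
  intro S hS
  obtain ⟨h, ⟨h0, hs⟩, hd⟩ := exists_isExpansionRelation_of_expansionComplexity_lt S N hN hS
  have hlt : Real.sqrt N / c * h.totalDegree < N := by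
    have hpos : 0 < Real.sqrt N / c := by
      have : 0 < Real.sqrt N := pos_of_mul_pos_right (one_pos.trans hN) hc.le
      positivity
    calc Real.sqrt N / c * h.totalDegree < Real.sqrt N / c * (c * Real.sqrt N) :=
          mul_lt_mul_of_pos_left hd hpos
      _ = N := by
          rw [div_mul_eq_mul_div, mul_left_comm, mul_div_assoc, Real.mul_self_sqrt (by positivity)]
          field_simp
  obtain ⟨p, hp, hph, hps⟩ := exists_irreducible_dvd_of_X_pow_dvd_aeval (generatingFunction S)
    (by positivity) h h0 N hs hlt
  have hple : p.totalDegree ≤ h.totalDegree :=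
    MvPolynomial.totalDegree_le_of_dvd_of_isDomain hph h0
  have hp1 : 1 ≤ p.totalDegree := by
    rw [Nat.one_le_iff_ne_zero]
    intro hp0
    rw [MvPolynomial.totalDegree_eq_zero_iff_eq_C] at hp0
    have hc0 : p.coeff 0 ≠ 0 := by
      intro h1
      rw [h1, map_zero] at hp0
      exact hp.ne_zero hp0
    exact hp.not_isUnit (hp0 ▸ (isUnit_iff_ne_zero.2 hc0).map MvPolynomial.C)
  simp only [Set.mem_iUnion, Finset.mem_Icc]
  refine ⟨p.totalDegree, ⟨hp1, Nat.le_floor ?_⟩, (Polynomial.Bivariate.equivMvPolynomial F).symm p,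
    (MulEquiv.irreducible_iff _).2 hp, Polynomial.totalDegreeLE_equivMvPolynomial_symm p, ?_⟩
  · exact (Nat.cast_le.2 hple).trans hd.le
  · rwa [Polynomial.eval₂_equivMvPolynomial_symm]

/-! ### Borel–Cantelli and the limit `c → 1`. -/

section Probability

variable {F : Type*} [Field F] [Fintype F] [MeasurableSpace F] [MeasurableSingletonClass F]

theorem uniformSequenceMeasure_expansionComplexity_lt_le {c : ℝ} (hc : 0 < c) (hc1 : c < 1)
    {N : ℕ} (hN : 1 < c * Real.sqrt N) (hN2 : 2 ≤ (c⁻¹ - c) * Real.sqrt N) :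
    uniformSequenceMeasure F {S | (expansionComplexity S N : ℝ) < c * Real.sqrt N} ≤
      ENNReal.ofReal (4 * ((N : ℝ) ^ 2 *
        Real.exp (-(Real.log 2 * (c⁻¹ - c)) * Real.sqrt N))) := by
  set E := Real.exp (-(Real.log 2 * (c⁻¹ - c)) * Real.sqrt N) with hE
  have hN1 : (1 : ℝ) ≤ N := by
    rcases Nat.eq_zero_or_pos N with rfl | h
    · norm_num at hN
    · exact_mod_cast h
  have hsqrt : c * Real.sqrt N ≤ N := by
    have h1 : Real.sqrt N ≤ N := Real.sqrt_le_iff.2 ⟨by linarith, by nlinarith⟩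
    nlinarith [Real.sqrt_nonneg (N : ℝ)]
  have hfloor : ⌊c * Real.sqrt N⌋₊ ≤ N := Nat.floor_le_of_le hsqrt
  refine (measure_mono (setOf_expansionComplexity_lt_subset hc hN)).trans
    ((measure_biUnion_finset_le _ _).trans ?_)
  have hterm : ∀ k ∈ Finset.Icc 1 ⌊c * Real.sqrt N⌋₊,
      uniformSequenceMeasure F (relationEvent F k ⌈Real.sqrt N / c * k⌉₊) ≤
        ENNReal.ofReal (N * (4 * E)) := by
    intro k hk
    rw [Finset.mem_Icc] at hk
    have hk1 : (1 : ℝ) ≤ k := by exact_mod_cast hk.1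
    have hkc : (k : ℝ) ≤ c * Real.sqrt N := (Nat.le_floor_iff (by positivity)).1 hk.2
    -- With `k ≤ c √N`, the gap is at least `k((c⁻¹ - c)√N - 1) - 1`, smallest at `k = 1`. The `-2`
    -- gives the factor `4 = 2^2`.
    have hreal : ((k ^ 2 + k + 1 : ℕ) : ℝ) + ((c⁻¹ - c) * Real.sqrt N - 2) ≤
        Real.sqrt N / c * k := by
      push_cast
      rw [div_eq_mul_inv]
      nlinarith [mul_nonneg (sub_nonneg.2 hk1) (sub_nonneg.2 hN2),
        mul_nonneg (zero_le_one.trans hk1) (sub_nonneg.2 hkc)]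
    have hceil := Nat.le_ceil (Real.sqrt N / c * k)
    have hle : k ^ 2 + k + 1 ≤ ⌈Real.sqrt N / c * k⌉₊ := by
      have : ((k ^ 2 + k + 1 : ℕ) : ℝ) ≤ ⌈Real.sqrt N / c * k⌉₊ := by linarith
      exact_mod_cast this
    refine (uniformSequenceMeasure_relationEvent_le_two_pow hle).trans ?_
    have hm : (c⁻¹ - c) * Real.sqrt N - 2 ≤
        ((⌈Real.sqrt N / c * k⌉₊ - (k ^ 2 + k + 1) : ℕ) : ℝ) := by
      rw [Nat.cast_sub hle]
      linarith
    rw [ENNReal.ofReal_mul (by positivity), ENNReal.ofReal_natCast]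
    gcongr
    · exact hk.2.trans hfloor
    · rw [show (2 : ENNReal)⁻¹ = ENNReal.ofReal 2⁻¹ by
        rw [ENNReal.ofReal_inv_of_pos two_pos, ENNReal.ofReal_ofNat],
        ← ENNReal.ofReal_pow (by norm_num)]
      refine ENNReal.ofReal_le_ofReal ?_
      rw [← Real.rpow_natCast, Real.inv_rpow two_pos.le, ← Real.rpow_neg two_pos.le,
        Real.rpow_def_of_pos two_pos, hE, ← Real.exp_log (show (0 : ℝ) < 4 by norm_num),
        ← Real.exp_add, Real.exp_le_exp, show (4 : ℝ) = 2 ^ 2 by norm_num, Real.log_pow]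
      push_cast
      nlinarith [mul_le_mul_of_nonneg_left hm (Real.log_nonneg one_le_two)]
  refine (Finset.sum_le_sum hterm).trans ?_
  rw [Finset.sum_const, nsmul_eq_mul, Nat.card_Icc, Nat.add_sub_cancel]
  calc (⌊c * Real.sqrt N⌋₊ : ENNReal) * ENNReal.ofReal (N * (4 * E))
      ≤ ENNReal.ofReal N * ENNReal.ofReal (N * (4 * E)) := by
        rw [ENNReal.ofReal_natCast]; gcongr
    _ = ENNReal.ofReal (4 * ((N : ℝ) ^ 2 * E)) := by
        rw [← ENNReal.ofReal_mul (by positivity)]; congr 1; ring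

theorem ae_eventually_mul_sqrt_le_expansionComplexity {c : ℝ} (hc : 0 < c) (hc1 : c < 1) :
    ∀ᵐ S ∂(uniformSequenceMeasure F), ∀ᶠ N : ℕ in atTop,
      c * Real.sqrt N ≤ (expansionComplexity S N : ℝ) := by
  have hδ : 0 < c⁻¹ - c := sub_pos.2 (hc1.trans ((one_lt_inv₀ hc).2 hc1))
  have hlim := Real.tendsto_sqrt_atTop.comp (tendsto_natCast_atTop_atTop (R := ℝ))
  obtain ⟨N₀, hN₀⟩ := eventually_atTop.1 (((hlim.const_mul_atTop hc).eventually_gt_atTop 1).and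
    ((hlim.const_mul_atTop hδ).eventually_ge_atTop 2))
  have hsum := (summable_sq_mul_exp_neg_mul_sqrt
    (mul_pos (Real.log_pos one_lt_two) hδ)).mul_left 4
  have hfin : ∑' N, uniformSequenceMeasure F
      {S | N₀ ≤ N ∧ (expansionComplexity S N : ℝ) < c * Real.sqrt N} ≠ ⊤ := by
    refine ne_top_of_le_ne_top hsum.tsum_ofReal_ne_top (ENNReal.tsum_le_tsum fun N => ?_)
    by_cases h : N₀ ≤ N
    · obtain ⟨h1, h2⟩ := hN₀ N h
      simpa only [h, true_and] using
        uniformSequenceMeasure_expansionComplexity_lt_le (F := F) hc hc1 h1 h2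
    · simp [h]
  filter_upwards [ae_eventually_notMem hfin] with S hS
  filter_upwards [hS, eventually_ge_atTop N₀] with N h1 h2
  by_contra! hlt
  exact h1 ⟨h2, hlt⟩

end Probability

theorem theorem4 (F : Type*) [Field F] [Fintype F] [MeasurableSpace F]
    [MeasurableSingletonClass F] :
    ∀ᵐ S ∂(uniformSequenceMeasure F),
      (1 : EReal) ≤ liminf
        (fun N : ℕ => (((expansionComplexity S N : ℝ) / Real.sqrt (N : ℝ) : ℝ) : EReal))
        atTop := by
  -- Countably many `c = 1 - 1/(j+2)` suffice; the shift keeps `c` positive at `j = 0`.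
  have hae : ∀ᵐ S ∂(uniformSequenceMeasure F), ∀ j : ℕ, ∀ᶠ N : ℕ in atTop,
      (1 - 1 / ((j + 1 : ℕ) + 1 : ℝ)) * Real.sqrt N ≤ (expansionComplexity S N : ℝ) := by
    refine ae_all_iff.2 fun j => ae_eventually_mul_sqrt_le_expansionComplexity ?_ ?_
    · rw [sub_pos, div_lt_one (by positivity)]
      push_cast
      linarith [(Nat.cast_nonneg j : (0 : ℝ) ≤ j)]
    · rw [sub_lt_self_iff]
      positivity
  filter_upwards [hae] with S hS
  have hlim : Tendsto (fun j : ℕ => ((1 - 1 / ((j + 1 : ℕ) + 1 : ℝ) : ℝ) : EReal)) atTop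
      (nhds (1 : EReal)) := by
    have h1 := ((tendsto_one_div_add_atTop_nhds_zero_nat (𝕜 := ℝ)).comp
      (tendsto_add_atTop_nat 1)).const_sub 1
    rw [sub_zero] at h1
    exact (continuous_coe_real_ereal.tendsto 1).comp h1
  refine le_of_tendsto' hlim fun j => le_liminf_of_le (by isBoundedDefault) ?_
  filter_upwards [hS j, eventually_gt_atTop 0] with N h1 h2
  rw [EReal.coe_le_coe_iff, le_div_iff₀ (Real.sqrt_pos.2 (by exact_mod_cast h2))]
  exact h1
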